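/- Let $R$ be a finite ring (unital, $1\ne 0$, not necessarily commutative), $d\ge 2$ an integer and $t\in R^\times$. Equip the space $V$ of complex-valued functions on $R^d$ with the norm $\|f\|_2=\big(\sum_{x\in R^d}|f(x)|^2\big)^{1/2}$, let $W\subset V$ be the subspace of functions with $\sum_{x}f(x)=0$, and let $A_t:W\to V$ be the operator $$A_tf(x)=\sum_{y\in R^d:\; y_1x_1+\cdots+y_dx_d=t}f(y).$$ Let $\|A_t\|_2$ be its operator norm with respect to $\|\cdot\|_2$. The $d$-dimensional $t$-Incidence-Salem number of $R$ is $\|A_t\|_2/|R|^{(d-1)/2}$, and $A_t$ is said to satisfy the $C$-Salem bound if $\|A_tf\|_2\le C|R|^{(d-1)/2}\|f\|_2$ for all $f\in W$. Pairs $(R,t)$ and $(R',t')$ are identified if there is a ring isomorphism $R\to R'$ carrying $t$ to $t'$. **Theorem.** Fix a constant $C>0$ and an integer $d\ge 2$. 1. Up to isomorphism there are only finitely many pairs $(R,t)$, with $R$ a finite ring that is not a field and $t\in R^\times$, for which the $d$-dimensional $t$-Incidence-Salem number of $R$ is less than $C$. 2. If $(R_i,t_i)_{i\ge 1}$ is a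 sequence of pairs of finite rings $R_i$ and units $t_i\in R_i^\times$ such that $|R_i|\to\infty$ and every $A_{t_i}$ (acting on mean-zero functions on $R_i^d$) satisfies the $C$-Salem bound, then $R_i$ is a field for all sufficiently large $i$. -/

import Mathlib

universe u

noncomputable section

namespace IncidenceSalem

/-- The space of complex-valued functions on `R ^ d`, with norm `(∑ x, ‖f x‖ ^ 2) ^ (1 / 2)`. -/
abbrev V (d : ℕ) (R : Type*) [Fintype R] : Type _ := EuclideanSpace ℂ (Fin d → R)

/-- The subspace of mean-zero functions. -/
def W (d : ℕ) (R : Type*) [Fintype R] : Submodule ℂ (V d R) where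
  carrier := {f | ∑ x, f x = 0}
  zero_mem' := by simp
  add_mem' := by
    intro f g hf hg
    simp only [Set.mem_ofPred_eq, PiLp.add_apply, Finset.sum_add_distrib] at *
    rw [hf, hg, add_zero]
  smul_mem' := by
    intro c f hf
    simp only [Set.mem_ofPred_eq, PiLp.smul_apply, ← Finset.smul_sum] at *
    rw [hf, smul_zero]

open scoped Classical in
/-- The operator `(A' f) x = ∑ f y`, over all `y` with `y₁ x₁ + ⋯ + y_d x_d = t`,
on all functions. -/
def opAll (d : ℕ) {R : Type*} [Ring R] [Fintype R] (t : Rˣ) : V d R →ₗ[ℂ] V d R where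
  toFun f := WithLp.toLp 2 fun x => ∑ y with dotProduct y x = (t : R), f y
  map_add' f g := by
    ext x
    simp [Finset.sum_add_distrib]
  map_smul' c f := by
    ext x
    simp [Finset.mul_sum]

/-- The operator `A_t`, from mean-zero functions to all functions. -/
def op (d : ℕ) {R : Type*} [Ring R] [Fintype R] (t : Rˣ) : W d R →L[ℂ] V d R :=
  LinearMap.toContinuousLinearMap ((opAll d t).domRestrict (W d R))

/-- The `d`-dimensional `t`-Incidence-Salem number of `R`. -/
def salemNumber (d : ℕ) {R : Type*} [Ring R] [Fintype R] (t : Rˣ) : ℝ :=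
  ‖op d t‖ / (Fintype.card R : ℝ) ^ (((d : ℝ) - 1) / 2)

/-- The `C`-Salem bound for `A_t`. -/
def IsSalem (C : ℝ) (d : ℕ) {R : Type*} [Ring R] [Fintype R] (t : Rˣ) : Prop :=
  ∀ f ∈ W d R, ‖opAll d t f‖ ≤ C * (Fintype.card R : ℝ) ^ (((d : ℝ) - 1) / 2) * ‖f‖

/-- Pairs `(R, t)` of a finite, unital, not necessarily commutative ring with `1 ≠ 0`
and a unit of it. -/
structure RingUnitPair where
  /-- the ring -/
  R : Type u
  [ring : Ring R]
  [fintype : Fintype R]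
  [nontrivial : Nontrivial R]
  /-- the unit -/
  t : Rˣ

attribute [instance] RingUnitPair.ring RingUnitPair.fintype RingUnitPair.nontrivial

/-- Pairs are identified along ring isomorphisms that carry one unit to the other. -/
instance RingUnitPair.isoSetoid : Setoid RingUnitPair.{u} where
  r P Q := ∃ e : P.R ≃+* Q.R, e (P.t : P.R) = (Q.t : Q.R)
  iseqv :=
    { refl := fun P => ⟨RingEquiv.refl P.R, rfl⟩
      symm := fun {P Q} ⟨e, he⟩ => ⟨e.symm, by rw [← he, e.symm_apply_apply]⟩
      trans := fun {P Q S} ⟨e, he⟩ ⟨e', he'⟩ => ⟨e.trans e', by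
        rw [RingEquiv.trans_apply, he, he']⟩ }

end IncidenceSalem

end

namespace IncidenceSalem

/-! Write Q = |R| and let K be a proper right ideal with k elements. Since K contains no unit, no
vector of K^d is incident to any x, so `A_t` maps the mean-zero function 1_{a+K^d} - 1_{K^d} to the
incidence count of the coset a + K^d (`opAll_cosetFun`). A nonzero count is at least k^(d-1), while
the average of the counts is bounded below through the number U of unimodular vectors. Summing the
Salem bound over all a therefore gives U k^(d-1) ≤ 2 C^2 Q^d (`IsSalem.card_isUnimodular_mul_le`).

It remains to make k U / Q^d large when R is large and not a field (`exists_mul_sq_card_le`). By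
Wedderburn's theorem R has zero divisors, hence a proper right ideal with k ≥ √Q. Unimodular pairs
always have density at least 1/√Q, which suffices if k is much larger than √Q; if the largest k is
close to √Q, that density is bounded below by a constant. So Q is bounded in terms of C, which
yields both claims. -/

/-- The kernel of an additive homomorphism has at least the average cardinality of a fibre. -/
theorem card_le_card_ker_mul {G H : Type*} [AddGroup G] [AddGroup H] [Finite G] [Finite H]
    (f : G →+ H) : Nat.card G ≤ Nat.card f.ker * Nat.card H := by
  rw [← AddSubgroup.card_mul_index f.ker, AddSubgroup.index_ker]
  exact Nat.mul_le_mul_left _ (Nat.card_le_card_of_injective _ Subtype.val_injective)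

/-! ### Right ideals and unimodular pairs in a finite ring. -/

section RightIdeals

variable {R : Type*} [Ring R]

/-- The principal right ideal `x R`. -/
abbrev rightSpan (x : R) : Submodule Rᵐᵒᵖ R := Submodule.span Rᵐᵒᵖ {x}

theorem mem_rightSpan {x y : R} : y ∈ rightSpan x ↔ ∃ r, x * r = y := by
  rw [Submodule.mem_span_singleton]
  exact ⟨fun ⟨r, hr⟩ => ⟨r.unop, hr⟩, fun ⟨r, hr⟩ => ⟨MulOpposite.op r, hr⟩⟩

/-- The right annihilator of an element. -/
def rightAnnihilator (x : R) : Submodule Rᵐᵒᵖ R where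
  carrier := {r | x * r = 0}
  zero_mem' := mul_zero x
  add_mem' {a b} ha hb := by
    change x * (a + b) = 0
    rw [mul_add, show x * a = 0 from ha, show x * b = 0 from hb, add_zero]
  smul_mem' c r hr := by
    change x * (r * c.unop) = 0
    rw [← mul_assoc, show x * r = 0 from hr, zero_mul]

theorem card_rightSpan_mul_card_rightAnnihilator (x : R) :
    Nat.card (rightAnnihilator x) * Nat.card (rightSpan x) = Nat.card R := by
  rw [← AddSubgroup.card_mul_index (AddMonoidHom.mulLeft x).ker, AddSubgroup.index_ker]
  congr 1
  refine Nat.card_congr (Equiv.setCongr ?_)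
  ext y
  exact mem_rightSpan

theorem card_top_submodule : Nat.card (⊤ : Submodule Rᵐᵒᵖ R) = Nat.card R :=
  Nat.card_congr (Submodule.topEquiv (R := Rᵐᵒᵖ) (M := R)).toEquiv

/-- Second isomorphism theorem: I/(I ⊓ J) ≅ (I ⊔ J)/J. -/
theorem card_sup_mul_card_inf (I J : Submodule Rᵐᵒᵖ R) :
    Nat.card (I ⊔ J : Submodule Rᵐᵒᵖ R) * Nat.card (I ⊓ J : Submodule Rᵐᵒᵖ R) =
      Nat.card I * Nat.card J := by
  have h1 := Submodule.card_eq_card_quotient_mul_card (Submodule.comap I.subtype (I ⊓ J))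
  have h2 := Submodule.card_eq_card_quotient_mul_card (Submodule.comap (I ⊔ J).subtype J)
  rw [← Nat.card_congr (LinearMap.quotientInfEquivSupQuotient I J).toEquiv] at h2
  have e1 : Nat.card (Submodule.comap I.subtype (I ⊓ J)) = Nat.card (I ⊓ J : Submodule Rᵐᵒᵖ R) :=
    Nat.card_congr (Submodule.comapSubtypeEquivOfLe inf_le_left).toEquiv
  have e2 : Nat.card (Submodule.comap (I ⊔ J).subtype J) = Nat.card J :=
    Nat.card_congr (Submodule.comapSubtypeEquivOfLe le_sup_right).toEquiv
  rw [e1] at h1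
  rw [e2] at h2
  rw [h1, h2, Submodule.comap_inf]
  ring

theorem card_submodule_le [Finite R] {I J : Submodule Rᵐᵒᵖ R} (h : I ≤ J) : Nat.card I ≤ Nat.card J :=
  Nat.card_le_card_of_injective _ (Submodule.inclusion_injective h)

theorem two_mul_card_le_of_ne_top [Finite R] {I : Submodule Rᵐᵒᵖ R} (h : I ≠ ⊤) :
    2 * Nat.card I ≤ Nat.card R := by
  have h1 := Submodule.card_eq_card_quotient_mul_card I
  have : Finite (R ⧸ I) := Finite.of_surjective _ (Submodule.mkQ_surjective I)
  have : Nontrivial (R ⧸ I) := Submodule.Quotient.nontrivial_iff.2 h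
  have h2 : 1 < Nat.card (R ⧸ I) := Finite.one_lt_card
  rw [h1, mul_comm]
  exact Nat.mul_le_mul_left _ h2

/-- The pairs of elements that generate the unit right ideal. -/
def IsUnimodularPair (x y : R) : Prop := ∃ r s, x * r + y * s = 1

theorem isUnimodularPair_iff {x y : R} :
    IsUnimodularPair x y ↔ rightSpan x ⊔ rightSpan y = ⊤ := by
  have h : (rightSpan x ⊔ rightSpan y = ⊤) ↔ (1 : R) ∈ rightSpan x ⊔ rightSpan y := by
    refine ⟨fun h => h ▸ Submodule.mem_top, fun h => ?_⟩
    refine (Submodule.eq_top_iff').2 fun z => ?_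
    simpa using Submodule.smul_mem _ (MulOpposite.op z) h
  rw [h, Submodule.mem_sup]
  simp only [mem_rightSpan]
  constructor
  · rintro ⟨r, s, h⟩
    exact ⟨_, ⟨r, rfl⟩, _, ⟨s, rfl⟩, h⟩
  · rintro ⟨_, ⟨r, rfl⟩, _, ⟨s, rfl⟩, h⟩
    exact ⟨r, s, h⟩

variable [Finite R]

theorem card_le_card_rightSpan_mul (x : R) :
    Nat.card R ≤ Nat.card (rightSpan x) * Nat.card (rightSpan (1 - x)) := by
  have h : rightSpan x ⊔ rightSpan (1 - x) = ⊤ := isUnimodularPair_iff.1 ⟨1, 1, by simp⟩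
  rw [← card_sup_mul_card_inf, h, card_top_submodule]
  exact Nat.le_mul_of_pos_right _ Nat.card_pos

/-- Every y = 1 - x + xr completes x, because x(1 - r) + y = 1. -/
theorem card_rightSpan_le_card_isUnimodularPair (x : R) :
    Nat.card (rightSpan x) ≤ Nat.card {y // IsUnimodularPair x y} := by
  refine Nat.card_le_card_of_injective (fun z : rightSpan x => ⟨1 - x + z, ?_⟩) fun z w h => ?_
  · obtain ⟨r, hr⟩ := mem_rightSpan.1 z.2
    refine ⟨1 - r, 1, ?_⟩
    rw [← hr]
    noncomm_ring
  · simpa using h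

/-- In a finite ring, at least `|R| ^ (3 / 2)` pairs generate the unit right ideal. -/
theorem mul_sqrt_card_le_card_isUnimodularPair :
    (Nat.card R : ℝ) * √(Nat.card R) ≤ Nat.card {p : R × R // IsUnimodularPair p.1 p.2} := by
  have := Fintype.ofFinite R
  have e : Nat.card {p : R × R // IsUnimodularPair p.1 p.2} =
      ∑ x : R, Nat.card {y // IsUnimodularPair x y} := by
    rw [← Nat.card_sigma]
    exact Nat.card_congr
      (Equiv.subtypeProdEquivSigmaSubtype (fun x y : R => IsUnimodularPair x y))
  -- AM-GM. As x ↦ 1 - x permutes R, the average of |xR| is then at least √|R|.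
  have h1 : ∀ x : R, 2 * √(Nat.card R) ≤
      (Nat.card (rightSpan x) : ℝ) + Nat.card (rightSpan (1 - x)) := by
    intro x
    have h : (Nat.card R : ℝ) ≤ Nat.card (rightSpan x) * Nat.card (rightSpan (1 - x)) := by
      exact_mod_cast card_le_card_rightSpan_mul x
    have h' := Real.sq_sqrt (Nat.cast_nonneg (α := ℝ) (Nat.card R))
    refine abs_le_of_sq_le_sq' ?_ (by positivity) |>.2
    nlinarith [sq_nonneg ((Nat.card (rightSpan x) : ℝ) - Nat.card (rightSpan (1 - x)))]
  have h2 : ∑ x : R, (Nat.card (rightSpan (1 - x)) : ℝ) = ∑ x : R, (Nat.card (rightSpan x) : ℝ) :=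
    Equiv.sum_comp (Equiv.subLeft (1 : R)) fun x => (Nat.card (rightSpan x) : ℝ)
  have h3 := Finset.sum_le_sum fun x (_ : x ∈ Finset.univ) => h1 x
  rw [Finset.sum_add_distrib, h2, Finset.sum_const, Finset.card_univ, nsmul_eq_mul,
    ← Nat.card_eq_fintype_card] at h3
  have h4 : ∑ x : R, (Nat.card (rightSpan x) : ℝ) ≤
      ∑ x : R, (Nat.card {y // IsUnimodularPair x y} : ℝ) :=
    Finset.sum_le_sum fun x _ => by exact_mod_cast card_rightSpan_le_card_isUnimodularPair x
  rw [e]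
  push_cast
  linarith

/-- If all proper right ideals have at most `k` elements and `k ^ 3 < |R| ^ 2`, then at least
about half of all pairs generate the unit right ideal. -/
theorem card_isUnimodularPair_ge {k : ℕ}
    (hk : ∀ I : Submodule Rᵐᵒᵖ R, I ≠ ⊤ → Nat.card I ≤ k) (hR : k ^ 3 < Nat.card R ^ 2) :
    Nat.card R * (Nat.card R - 1) ≤ 2 * Nat.card {p : R × R // IsUnimodularPair p.1 p.2} := by
  have := Fintype.ofFinite R
  have e : Nat.card {p : R × R // IsUnimodularPair p.1 p.2} =
      ∑ x : R, Nat.card {y // IsUnimodularPair x y} := by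
    rw [← Nat.card_sigma]
    exact Nat.card_congr
      (Equiv.subtypeProdEquivSigmaSubtype (fun x y : R => IsUnimodularPair x y))
  have key : ∀ x : R, x ≠ 0 → Nat.card R ≤ 2 * Nat.card {y // IsUnimodularPair x y} := by
    intro x hx
    obtain hxt | ⟨M, hM, hxM⟩ := eq_top_or_exists_le_coatom (rightSpan x)
    · have : ∀ y, IsUnimodularPair x y := fun y => by rw [isUnimodularPair_iff, hxt, top_sup_eq]
      rw [Nat.card_congr (Equiv.subtypeUnivEquiv this)]
      lia
    · have hann : Nat.card (rightAnnihilator x) ≤ k := by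
        refine hk _ fun h => hx ?_
        have h1 : (1 : R) ∈ rightAnnihilator x := h ▸ Submodule.mem_top
        simpa using (show x * 1 = 0 from h1)
      have hspan : Nat.card R ≤ k * Nat.card (rightSpan x) := by
        rw [← card_rightSpan_mul_card_rightAnnihilator x]
        exact Nat.mul_le_mul_right _ hann
      -- If I = xR + yR were proper, then M + I = R and xR ⊆ M ∩ I would give |R| |xR| ≤ |M| |I| ≤
      -- k^2. With |xR| ≥ |R|/k this contradicts k^3 < |R|^2.
      have hy : ∀ y ∉ M, IsUnimodularPair x y := by
        intro y hyM
        rw [isUnimodularPair_iff]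
        by_contra hI
        set I := rightSpan x ⊔ rightSpan y with hIdef
        have hyI : y ∈ I := (le_sup_right : rightSpan y ≤ I) (Submodule.mem_span_singleton_self y)
        have hsup : M ⊔ I = ⊤ := hM.2 _ (left_lt_sup.2 fun h => hyM (h hyI))
        have hc := card_sup_mul_card_inf M I
        rw [hsup, card_top_submodule] at hc
        have h1 : Nat.card (rightSpan x) ≤ Nat.card (M ⊓ I : Submodule Rᵐᵒᵖ R) :=
          card_submodule_le (le_inf hxM le_sup_left)
        have h2 : Nat.card M * Nat.card I ≤ k * k := Nat.mul_le_mul (hk M hM.1) (hk I hI)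
        have h3 : Nat.card R * Nat.card (rightSpan x) ≤ k * k :=
          (Nat.mul_le_mul_left _ h1).trans (hc.le.trans h2)
        refine hR.not_ge ?_
        calc Nat.card R ^ 2 = Nat.card R * Nat.card R := sq _
          _ ≤ Nat.card R * (k * Nat.card (rightSpan x)) := Nat.mul_le_mul_left _ hspan
          _ = k * (Nat.card R * Nat.card (rightSpan x)) := by ring
          _ ≤ k * (k * k) := Nat.mul_le_mul_left _ h3
          _ = k ^ 3 := by ring
      have h1 : Nat.card {y // y ∉ M} ≤ Nat.card {y // IsUnimodularPair x y} :=
        Nat.card_le_card_of_injective (Subtype.map id hy) (Subtype.map_injective _ Function.injective_id)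
      have h2 := two_mul_card_le_of_ne_top hM.1
      have h3 : Nat.card M + Nat.card {y // y ∉ M} = Nat.card R := by
        classical
        rw [← Nat.card_sum]
        exact Nat.card_congr (Equiv.sumCompl (· ∈ M))
      lia
  classical
  rw [e, Finset.mul_sum]
  calc Nat.card R * (Nat.card R - 1) = ∑ x ∈ Finset.univ.erase (0 : R), Nat.card R := by
        rw [Finset.sum_const, Finset.card_erase_of_mem (Finset.mem_univ _), Finset.card_univ,
          Nat.card_eq_fintype_card, smul_eq_mul, mul_comm]
    _ ≤ ∑ x ∈ Finset.univ.erase (0 : R), 2 * Nat.card {y // IsUnimodularPair x y} :=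
        Finset.sum_le_sum fun x hx => key x (Finset.ne_of_mem_erase hx)
    _ ≤ _ := Finset.sum_le_sum_of_subset (Finset.subset_univ _)

/-- A finite ring that is not a field has a proper right ideal of at least `|R| ^ (1 / 2)`
elements. -/
theorem exists_card_le_sq_of_not_isField [Nontrivial R] (hR : ¬ IsField R) :
    ∃ I : Submodule Rᵐᵒᵖ R, I ≠ ⊤ ∧ Nat.card R ≤ Nat.card I ^ 2 := by
  -- Wedderburn's little theorem. If ab = 0 with a, b ≠ 0, both aR and the right annihilator of a
  -- are proper, and the product of their orders is |R|.
  have hdom : ¬ NoZeroDivisors R := fun h => by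
    have := NoZeroDivisors.to_isDomain R
    exact hR (Finite.isDomain_to_isField R)
  obtain ⟨a, b, hab, ha, hb⟩ : ∃ a b : R, a * b = 0 ∧ a ≠ 0 ∧ b ≠ 0 := by
    by_contra! h
    exact hdom ⟨fun {a b} hab => or_iff_not_imp_left.2 fun ha => h a b hab ha⟩
  have hc := card_rightSpan_mul_card_rightAnnihilator a
  have h1 : rightAnnihilator a ≠ ⊤ := fun h => ha <| by
    have h1 : (1 : R) ∈ rightAnnihilator a := h ▸ Submodule.mem_top
    simpa using (show a * 1 = 0 from h1)
  have h2 : rightSpan a ≠ ⊤ := fun h => by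
    rw [h, card_top_submodule] at hc
    have hone : Nat.card (rightAnnihilator a) = 1 :=
      Nat.eq_of_mul_eq_mul_right (Nat.card_pos (α := R)) (by rw [hc, one_mul])
    have := (Nat.card_eq_one_iff_unique.1 hone).1
    have h0 := Subsingleton.elim (⟨b, hab⟩ : rightAnnihilator a) 0
    exact hb (congrArg Subtype.val h0)
  rcases le_total (Nat.card (rightAnnihilator a)) (Nat.card (rightSpan a)) with h | h
  · exact ⟨_, h2, by nlinarith⟩
  · exact ⟨_, h1, by nlinarith⟩

/-- In a large finite ring that is not a field, some proper right ideal is large compared to the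
inverse of the density of the pairs that generate the unit right ideal. -/
theorem exists_mul_sq_card_le [Nontrivial R] (hR : ¬ IsField R) {T : ℝ} (hT : 1 ≤ T)
    (hcard : 16 * T ^ 6 < Nat.card R) :
    ∃ I : Submodule Rᵐᵒᵖ R, I ≠ ⊤ ∧ T * (Nat.card R : ℝ) ^ 2 ≤
      Nat.card I * Nat.card {p : R × R // IsUnimodularPair p.1 p.2} := by
  obtain ⟨I₀, hI₀, hI₀c⟩ := exists_card_le_sq_of_not_isField hR
  have : Nonempty {I : Submodule Rᵐᵒᵖ R // I ≠ ⊤} := ⟨⟨I₀, hI₀⟩⟩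
  obtain ⟨⟨K, hK⟩, hmax⟩ :=
    Finite.exists_max fun I : {I : Submodule Rᵐᵒᵖ R // I ≠ ⊤} => Nat.card I.1
  refine ⟨K, hK, ?_⟩
  have hKc : Nat.card R ≤ Nat.card K ^ 2 := hI₀c.trans (Nat.pow_le_pow_left (hmax ⟨I₀, hI₀⟩) 2)
  have hu := mul_sqrt_card_le_card_isUnimodularPair (R := R)
  have hge := card_isUnimodularPair_ge (R := R) (k := Nat.card K) fun I hI => hmax ⟨I, hI⟩
  have hQpos : 0 < Nat.card R := Nat.card_pos
  set U := Nat.card {p : R × R // IsUnimodularPair p.1 p.2}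
  set Q := Nat.card R
  set k := Nat.card K
  set s := √(Q : ℝ) with hs
  have hsq : s ^ 2 = Q := Real.sq_sqrt (Nat.cast_nonneg _)
  have hs0 : 0 ≤ s := Real.sqrt_nonneg _
  have hsk : s ≤ k := by
    rw [hs, Real.sqrt_le_left (Nat.cast_nonneg _)]
    exact_mod_cast hKc
  have hsT : 4 * T ^ 3 < s := by
    refine (abs_lt_of_sq_lt_sq' ?_ hs0).2
    rw [hsq]
    linarith [show (4 * T ^ 3) ^ 2 = 16 * T ^ 6 by ring]
  have hT3 : T ≤ T ^ 3 := le_self_pow₀ hT (by norm_num)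
  -- If k ≥ T√Q, the general bound Q√Q on unimodular pairs suffices. Otherwise k^3 < T^3 Q√Q ≤ Q^2,
  -- so about half of all pairs are unimodular, and k ≥ √Q > 4T^3 ≥ 4T absorbs the loss.
  rcases le_or_gt (T * s) k with h | h
  · calc T * (Q : ℝ) ^ 2 = (T * s) * (Q * s) := by rw [← hsq]; ring
      _ ≤ k * U := mul_le_mul h hu (by positivity) (Nat.cast_nonneg _)
  · have hk3 : (k : ℝ) ^ 3 < (Q : ℝ) ^ 2 := by
      calc (k : ℝ) ^ 3 < (T * s) ^ 3 := pow_lt_pow_left₀ h (Nat.cast_nonneg _) (by norm_num)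
        _ = T ^ 3 * s ^ 3 := by ring
        _ ≤ s * s ^ 3 := by gcongr; linarith
        _ = (Q : ℝ) ^ 2 := by rw [← hsq]; ring
    have hge' := hge (by exact_mod_cast hk3)
    have hU : (Q : ℝ) * (Q - 1) ≤ 2 * U := by
      have : ((Q * (Q - 1) : ℕ) : ℝ) ≤ ((2 * U : ℕ) : ℝ) := by exact_mod_cast hge'
      rwa [Nat.cast_mul, Nat.cast_sub hQpos, Nat.cast_one, Nat.cast_mul] at this
    have hQ2 : (2 : ℝ) ≤ Q := by
      have : 1 ≤ T ^ 6 := one_le_pow₀ hT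
      linarith
    have hU' : (Q : ℝ) ^ 2 / 4 ≤ U := by nlinarith
    calc T * (Q : ℝ) ^ 2 = (4 * T) * ((Q : ℝ) ^ 2 / 4) := by ring
      _ ≤ (k : ℝ) * U := mul_le_mul (by linarith) hU' (by positivity) (Nat.cast_nonneg _)

end RightIdeals

/-! ### Incidences between points and cosets of K^d. -/

section Counting

variable {R : Type*} [Ring R]

/-- The vectors with all coordinates in a given right ideal. -/
def box (d : ℕ) (K : Submodule Rᵐᵒᵖ R) : Submodule Rᵐᵒᵖ (Fin d → R) :=
  Submodule.pi Set.univ fun _ => K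

theorem mem_box {d : ℕ} {K : Submodule Rᵐᵒᵖ R} {y : Fin d → R} : y ∈ box d K ↔ ∀ i, y i ∈ K := by
  simp [box]

theorem card_box (d : ℕ) (K : Submodule Rᵐᵒᵖ R) : Nat.card (box d K) = Nat.card K ^ d := by
  rw [← Nat.card_fin d, ← Nat.card_fun, Nat.card_fin]
  exact Nat.card_congr
    { toFun := fun y i => ⟨y.1 i, mem_box.1 y.2 i⟩
      invFun := fun z => ⟨fun i => z i, mem_box.2 fun i => (z i).2⟩
      left_inv := fun _ => rfl
      right_inv := fun _ => rfl }

theorem dotProduct_mem {d : ℕ} {K : Submodule Rᵐᵒᵖ R} {y : Fin d → R} (hy : y ∈ box d K)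
    (x : Fin d → R) : dotProduct y x ∈ K :=
  Submodule.sum_mem _ fun i _ => K.smul_mem (MulOpposite.op (x i)) (mem_box.1 hy i)

/-- A vector is unimodular if its coordinates generate the unit right ideal. -/
def IsUnimodular {d : ℕ} (y : Fin d → R) : Prop := ∃ z, dotProduct y z = 1

theorem card_isUnimodularPair_mul_le [Finite R] (e : ℕ) :
    Nat.card {p : R × R // IsUnimodularPair p.1 p.2} * Nat.card R ^ e ≤
      Nat.card {y : Fin (e + 2) → R // IsUnimodular y} := by
  rw [← Nat.card_fin e, ← Nat.card_fun, ← Nat.card_prod, Nat.card_fin]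
  refine Nat.card_le_card_of_injective
    (fun q => ⟨Fin.cons q.1.1.1 (Fin.cons q.1.1.2 q.2), ?_⟩) ?_
  · obtain ⟨r, s, h⟩ := q.1.2
    refine ⟨Fin.cons r (Fin.cons s 0), ?_⟩
    simp [dotProduct, Fin.sum_univ_succ, h]
  · rintro ⟨⟨⟨a, b⟩, h⟩, z⟩ ⟨⟨⟨a', b'⟩, h'⟩, z'⟩ hq
    simpa [Fin.cons_inj, and_assoc] using hq

variable [Fintype R]

open scoped Classical in
/-- The fibre of `x ↦ y ⬝ᵥ x` over any point has at least the average cardinality. -/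
theorem card_pow_le_card_dotProduct_eq {d : ℕ} {y : Fin d → R} (hy : IsUnimodular y) (t : R) :
    Nat.card R ^ d ≤ (Finset.univ.filter fun x => dotProduct y x = t).card * Nat.card R := by
  obtain ⟨z, hz⟩ := hy
  let φ : (Fin d → R) →+ R :=
    { toFun := fun x => dotProduct y x
      map_zero' := dotProduct_zero y
      map_add' := dotProduct_add y }
  have h := card_le_card_ker_mul φ
  rw [Nat.card_fun, Nat.card_eq_fintype_card (α := Fin d), Fintype.card_fin] at h
  refine h.trans (Nat.mul_le_mul_right _ ?_)
  rw [← Nat.card_eq_finsetCard]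
  -- If y · z = 1, then zt lies in the fibre over t, which is thus a translate of the kernel.
  refine Nat.card_le_card_of_injective (fun x : φ.ker => ⟨(fun i => z i * t) + x, ?_⟩)
    fun x x' h => ?_
  · have hx : dotProduct y x = 0 := x.2
    have hzt : dotProduct y (fun i => z i * t) = t := by
      calc dotProduct y (fun i => z i * t) = dotProduct y z * t := by
            simp [dotProduct, Finset.sum_mul, mul_assoc]
        _ = t := by rw [hz, one_mul]
    simp [dotProduct_add, hx, hzt]
  · simpa using h

open scoped Classical in
/-- The number of points of the coset `a + K ^ d` that are incident to `x`. -/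
noncomputable def cosetCount {d : ℕ} (K : Submodule Rᵐᵒᵖ R) (t : R) (a x : Fin d → R) : ℕ :=
  (Finset.univ.filter fun y => dotProduct y x = t ∧ y - a ∈ box d K).card

/-- A nonempty solution set in a + K^d contains a translate of the kernel of z ↦ z · x on K^d. This
additive map takes values in K, so its kernel has at least |K|^d / |K| elements. The form quadratic
in the count also covers the empty case. -/
theorem card_box_mul_cosetCount_le {d : ℕ} (K : Submodule Rᵐᵒᵖ R) (t : R) (a x : Fin d → R) :
    Nat.card (box d K) * cosetCount K t a x ≤ Nat.card K * cosetCount K t a x ^ 2 := by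
  classical
  rcases Nat.eq_zero_or_pos (cosetCount K t a x) with h0 | hpos
  · simp [h0]
  obtain ⟨y, hy⟩ := Finset.card_pos.1 hpos
  simp only [Finset.mem_filter, Finset.mem_univ, true_and] at hy
  let φ : box d K →+ K :=
    { toFun := fun z => ⟨dotProduct z.1 x, dotProduct_mem z.2 x⟩
      map_zero' := Subtype.ext (zero_dotProduct x)
      map_add' := fun z w => Subtype.ext (add_dotProduct z.1 w.1 x) }
  have h : Nat.card φ.ker ≤ cosetCount K t a x := by
    rw [cosetCount, ← Nat.card_eq_finsetCard]
    refine Nat.card_le_card_of_injective (fun z : φ.ker => ⟨y + z.1.1, ?_⟩) fun z w h => ?_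
    · have hz : dotProduct z.1.1 x = 0 := congrArg Subtype.val z.2
      have hmem : y + z.1.1 - a ∈ box d K := by
        rw [add_sub_right_comm]
        exact add_mem hy.2 z.1.2
      exact Finset.mem_filter.2
        ⟨Finset.mem_univ _, by rw [add_dotProduct, hz, hy.1, add_zero], hmem⟩
    · exact Subtype.ext (Subtype.ext (add_left_cancel (congrArg Subtype.val h)))
  calc Nat.card (box d K) * cosetCount K t a x
      ≤ (Nat.card φ.ker * Nat.card K) * cosetCount K t a x :=
        Nat.mul_le_mul_right _ (card_le_card_ker_mul φ)
    _ ≤ (cosetCount K t a x * Nat.card K) * cosetCount K t a x := by gcongr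
    _ = _ := by ring

/-- Double counting: each incident pair (y, x) is seen from exactly |K^d| shifts a, and a unimodular
y is incident to at least |R|^(d-1) points x. -/
theorem card_isUnimodular_mul_le_sum_cosetCount {d : ℕ} (K : Submodule Rᵐᵒᵖ R) (t : R) :
    Nat.card {y : Fin d → R // IsUnimodular y} * Nat.card R ^ d * Nat.card (box d K) ≤
      (∑ a : Fin d → R, ∑ x, cosetCount K t a x) * Nat.card R := by
  classical
  have hcoset : ∀ y : Fin d → R, ∑ a, (if y - a ∈ box d K then 1 else 0) = Nat.card (box d K) := by
    intro y
    refine (Equiv.sum_comp (Equiv.subLeft y) fun z => if z ∈ box d K then 1 else 0).trans ?_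
    rw [← Finset.card_filter]
    exact (Nat.subtype_card _ (by simp)).symm
  have hswap : ∑ a : Fin d → R, ∑ x, cosetCount K t a x =
      ∑ y : Fin d → R, (Finset.univ.filter fun x => dotProduct y x = t).card *
        Nat.card (box d K) := by
    calc ∑ a : Fin d → R, ∑ x, cosetCount K t a x
        = ∑ a : Fin d → R, ∑ x : Fin d → R, ∑ y : Fin d → R,
            (if dotProduct y x = t then 1 else 0) * (if y - a ∈ box d K then 1 else 0) := by
          refine Finset.sum_congr rfl fun a _ => Finset.sum_congr rfl fun x _ => ?_
          rw [cosetCount, Finset.card_filter]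
          refine Finset.sum_congr rfl fun y _ => ?_
          rw [ite_and, ite_mul, one_mul, zero_mul]
      _ = ∑ y : Fin d → R, ∑ x : Fin d → R, ∑ a : Fin d → R,
            (if dotProduct y x = t then 1 else 0) * (if y - a ∈ box d K then 1 else 0) := by
          rw [Finset.sum_congr rfl fun a _ => Finset.sum_comm, Finset.sum_comm]
          exact Finset.sum_congr rfl fun y _ => Finset.sum_comm
      _ = _ := by
          simp only [← Finset.mul_sum, hcoset, ← Finset.sum_mul, Finset.card_filter]
  rw [hswap, Finset.sum_mul,
    Nat.subtype_card (Finset.univ.filter fun y : Fin d → R => IsUnimodular y) (by simp), mul_assoc,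
    ← smul_eq_mul, ← Finset.sum_const]
  refine (Finset.sum_le_sum fun y hy => ?_).trans
    (Finset.sum_le_sum_of_subset (Finset.filter_subset _ _))
  have h := card_pow_le_card_dotProduct_eq (Finset.mem_filter.1 hy).2 t
  calc Nat.card R ^ d * Nat.card (box d K) ≤ _ * Nat.card (box d K) := Nat.mul_le_mul_right _ h
    _ = _ := by ring

end Counting

/-! ### Testing the operator on coset functions. -/

section Operator

variable {R : Type*} [Ring R] [Fintype R] {d : ℕ}

open scoped Classical in
/-- The difference of the indicator functions of `a + K ^ d` and `K ^ d`. -/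
noncomputable def cosetFun (K : Submodule Rᵐᵒᵖ R) (a : Fin d → R) : V d R :=
  WithLp.toLp 2 fun y => (if y - a ∈ box d K then 1 else 0) - (if y ∈ box d K then 1 else 0)

open scoped Classical in
theorem sum_ite_sub_mem_box {A : Type*} [AddCommMonoidWithOne A] (K : Submodule Rᵐᵒᵖ R)
    (a : Fin d → R) :
    ∑ y, (if y - a ∈ box d K then (1 : A) else 0) = Nat.card (box d K) := by
  refine (Equiv.sum_comp (Equiv.subRight a) fun z => if z ∈ box d K then (1 : A) else 0).trans ?_
  rw [Finset.sum_boole]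
  congr 1
  exact (Nat.subtype_card _ (by simp)).symm

theorem cosetFun_mem_W (K : Submodule Rᵐᵒᵖ R) (a : Fin d → R) : cosetFun K a ∈ W d R := by
  classical
  change ∑ y, ((if y - a ∈ box d K then (1 : ℂ) else 0) - (if y ∈ box d K then 1 else 0)) = 0
  have h0 := sum_ite_sub_mem_box (A := ℂ) K (0 : Fin d → R)
  simp only [sub_zero] at h0
  rw [Finset.sum_sub_distrib, sum_ite_sub_mem_box, h0, sub_self]

theorem norm_sq_cosetFun_le (K : Submodule Rᵐᵒᵖ R) (a : Fin d → R) :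
    ‖cosetFun K a‖ ^ 2 ≤ 2 * Nat.card (box d K) := by
  classical
  have h0 := sum_ite_sub_mem_box (A := ℝ) K (0 : Fin d → R)
  simp only [sub_zero] at h0
  rw [EuclideanSpace.norm_sq_eq, two_mul]
  nth_rewrite 1 [← sum_ite_sub_mem_box (A := ℝ) K a]
  rw [← h0, ← Finset.sum_add_distrib]
  refine Finset.sum_le_sum fun y _ => ?_
  simp only [cosetFun]
  split_ifs <;> norm_num

theorem opAll_cosetFun {K : Submodule Rᵐᵒᵖ R} (hK : K ≠ ⊤) (t : Rˣ) (a x : Fin d → R) :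
    opAll d t (cosetFun K a) x = cosetCount K (t : R) a x := by
  classical
  -- Otherwise the unit t = y · x would lie in K and force K = R.
  have hmem : ∀ y : Fin d → R, dotProduct y x = t → y ∉ box d K := by
    intro y hy h
    refine hK (Submodule.eq_top_iff'.2 fun z => ?_)
    have h1 := K.smul_mem (MulOpposite.op ((↑t⁻¹ : R) * z)) (hy ▸ dotProduct_mem h x)
    simpa using h1
  change ∑ y with dotProduct y x = (t : R),
    ((if y - a ∈ box d K then (1 : ℂ) else 0) - (if y ∈ box d K then 1 else 0)) = _
  rw [cosetCount, ← Finset.filter_filter, ← Finset.sum_boole]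
  refine Finset.sum_congr rfl fun y hy => ?_
  rw [if_neg (hmem y (Finset.mem_filter.1 hy).2), sub_zero]

/-- A Salem bound limits the density of the unimodular vectors. -/
theorem IsSalem.card_isUnimodular_mul_le [Nontrivial R] {C : ℝ} {t : Rˣ} (h : IsSalem C (d + 1) t)
    {K : Submodule Rᵐᵒᵖ R} (hK : K ≠ ⊤) :
    (Nat.card {y : Fin (d + 1) → R // IsUnimodular y} : ℝ) * Nat.card K ^ d ≤
      2 * C ^ 2 * Nat.card R ^ (d + 1) := by
  have hbound : ∀ a : Fin (d + 1) → R, ∑ x, (cosetCount K (t : R) a x : ℝ) ^ 2 ≤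
      C ^ 2 * Nat.card R ^ d * (2 * Nat.card (box (d + 1) K)) := by
    intro a
    have h1 := pow_le_pow_left₀ (norm_nonneg _) (h _ (cosetFun_mem_W K a)) 2
    rw [EuclideanSpace.norm_sq_eq, mul_pow, mul_pow, ← Real.rpow_natCast (_ ^ _ : ℝ) 2,
      ← Real.rpow_mul (Nat.cast_nonneg _)] at h1
    simp only [opAll_cosetFun hK, Complex.norm_natCast] at h1
    have h2 : (((d + 1 : ℕ) : ℝ) - 1) / 2 * ((2 : ℕ) : ℝ) = (d : ℕ) := by
      push_cast
      ring
    rw [h2, Real.rpow_natCast, ← Nat.card_eq_fintype_card] at h1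
    exact h1.trans (by gcongr; exact norm_sq_cosetFun_le K a)
  have hQ : (0 : ℝ) < Nat.card R := by exact_mod_cast Nat.card_pos (α := R)
  have hk : (0 : ℝ) < Nat.card K := by exact_mod_cast Nat.card_pos (α := K)
  have h1 := card_isUnimodular_mul_le_sum_cosetCount (d := d + 1) K (t : R)
  have h2 : Nat.card (box (d + 1) K) * ∑ a : Fin (d + 1) → R, ∑ x, cosetCount K (t : R) a x ≤
      Nat.card K * ∑ a : Fin (d + 1) → R, ∑ x, cosetCount K (t : R) a x ^ 2 := by
    simp only [Finset.mul_sum]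
    exact Finset.sum_le_sum fun a _ => Finset.sum_le_sum fun x _ =>
      card_box_mul_cosetCount_le K _ a x
  have h3 := Finset.sum_le_sum fun a (_ : a ∈ Finset.univ) => hbound a
  rw [Finset.sum_const, nsmul_eq_mul, Finset.card_univ, Fintype.card_fun, Fintype.card_fin,
    ← Nat.card_eq_fintype_card] at h3
  rw [card_box] at h1 h2 h3
  generalize (∑ a : Fin (d + 1) → R, ∑ x, cosetCount K (t : R) a x) = S at h1 h2
  have h1' : (Nat.card {y : Fin (d + 1) → R // IsUnimodular y} : ℝ) * Nat.card R ^ (d + 1) *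
    Nat.card K ^ (d + 1) ≤ S * Nat.card R := by exact_mod_cast h1
  have h2' : (Nat.card K : ℝ) ^ (d + 1) * S ≤
      Nat.card K * ∑ a : Fin (d + 1) → R, ∑ x, (cosetCount K (t : R) a x : ℝ) ^ 2 := by
    exact_mod_cast h2
  generalize (∑ a : Fin (d + 1) → R, ∑ x, (cosetCount K (t : R) a x : ℝ) ^ 2) = S₂ at h2' h3
  push_cast at h3
  generalize (Nat.card {y : Fin (d + 1) → R // IsUnimodular y} : ℝ) = U at *
  generalize (Nat.card R : ℝ) = Q at *
  generalize (Nat.card K : ℝ) = k at *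
  -- The chain combines the lower bound for S, the comparison of S with S₂ and the Salem bound for
  -- S₂; the common factor is chosen to avoid division.
  refine le_of_mul_le_mul_left ?_ (show 0 < k ^ (d + 2) * Q ^ (d + 1) by positivity)
  calc k ^ (d + 2) * Q ^ (d + 1) * (U * k ^ d)
      = k ^ (d + 1) * (U * Q ^ (d + 1) * k ^ (d + 1)) := by ring
    _ ≤ k ^ (d + 1) * (S * Q) := by gcongr
    _ = (k ^ (d + 1) * S) * Q := by ring
    _ ≤ (k * S₂) * Q := by gcongr
    _ ≤ (k * (Q ^ (d + 1) * (C ^ 2 * Q ^ d * (2 * k ^ (d + 1))))) * Q := by gcongr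
    _ = k ^ (d + 2) * Q ^ (d + 1) * (2 * C ^ 2 * Q ^ (d + 1)) := by ring

/-- Finite rings that are not fields and satisfy a Salem bound have bounded cardinality. -/
theorem IsSalem.card_le [Nontrivial R] {C : ℝ} {t : Rˣ} (hd : 2 ≤ d) (h : IsSalem C d t)
    (hR : ¬ IsField R) : (Fintype.card R : ℝ) ≤ 16 * (2 * C ^ 2 + 1) ^ 6 := by
  by_contra! hcard
  rw [← Nat.card_eq_fintype_card] at hcard
  -- Taken with T = 2C^2 + 1, just above the limit 2C^2 that the Salem bound imposes.
  obtain ⟨K, hK, hT⟩ := exists_mul_sq_card_le hR (by nlinarith [sq_nonneg C]) hcard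
  obtain ⟨e, rfl⟩ := Nat.exists_eq_add_of_le' hd
  have h1 := IsSalem.card_isUnimodular_mul_le (d := e + 1) h hK
  have h2 : (Nat.card {p : R × R // IsUnimodularPair p.1 p.2} : ℝ) * Nat.card R ^ e ≤
      Nat.card {y : Fin (e + 2) → R // IsUnimodular y} := by
    exact_mod_cast card_isUnimodularPair_mul_le e
  have hQ : (0 : ℝ) < Nat.card R := by exact_mod_cast Nat.card_pos (α := R)
  have hk : (1 : ℝ) ≤ Nat.card K := by exact_mod_cast Nat.card_pos (α := K)
  -- The exponent is d - 1 ≥ 1; this uses d ≥ 2.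
  have hk' : (Nat.card K : ℝ) ≤ Nat.card K ^ (e + 1) := le_self_pow₀ hk (by simp)
  have h3 : (2 * C ^ 2 + 1) * (Nat.card R : ℝ) ^ (e + 2) ≤
      2 * C ^ 2 * (Nat.card R : ℝ) ^ (e + 2) := by
    calc (2 * C ^ 2 + 1) * (Nat.card R : ℝ) ^ (e + 2)
        = (2 * C ^ 2 + 1) * (Nat.card R : ℝ) ^ 2 * (Nat.card R : ℝ) ^ e := by ring
      _ ≤ Nat.card K * Nat.card {p : R × R // IsUnimodularPair p.1 p.2} *
            (Nat.card R : ℝ) ^ e := by gcongr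
      _ = (Nat.card {p : R × R // IsUnimodularPair p.1 p.2} * (Nat.card R : ℝ) ^ e) *
            Nat.card K := by ring
      _ ≤ Nat.card {y : Fin (e + 2) → R // IsUnimodular y} * (Nat.card K : ℝ) ^ (e + 1) := by
          gcongr
      _ ≤ _ := h1
  have : (0 : ℝ) < (Nat.card R : ℝ) ^ (e + 2) := by positivity
  linarith

theorem isSalem_of_salemNumber_le [Nontrivial R] {C : ℝ} {t : Rˣ} (h : salemNumber d t ≤ C) :
    IsSalem C d t := by
  intro f hf
  have hQ : (0 : ℝ) < (Fintype.card R : ℝ) ^ (((d : ℝ) - 1) / 2) := by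
    have : (0 : ℝ) < Fintype.card R := by exact_mod_cast Fintype.card_pos
    positivity
  exact ((op d t).le_opNorm ⟨f, hf⟩).trans
    (mul_le_mul_of_nonneg_right ((div_le_iff₀ hQ).1 h) (norm_nonneg f))

end Operator

/-! ### Finiteness of isomorphism classes, and the theorem. -/

/-- There are finitely many isomorphism classes of pairs of bounded cardinality. -/
theorem RingUnitPair.finite_image_card_le (N : ℕ) :
    ((fun P : RingUnitPair.{u} => (⟦P⟧ : Quotient RingUnitPair.isoSetoid)) ''
      {P | Fintype.card P.R ≤ N}).Finite := by
  -- A pair is encoded by its addition and multiplication tables on `Fin n` and the index of its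
  -- unit; the code determines the isomorphism class.
  let code : {P : RingUnitPair.{u} // Fintype.card P.R ≤ N} →
      Σ n : Fin (N + 1), (Fin n → Fin n → Fin n) × (Fin n → Fin n → Fin n) × Fin n := fun P =>
    let e := Fintype.equivFin P.1.R
    ⟨⟨Fintype.card P.1.R, Nat.lt_succ_of_le P.2⟩,
      fun i j => e (e.symm i + e.symm j), fun i j => e (e.symm i * e.symm j), e (P.1.t : P.1.R)⟩
  let cls : {P : RingUnitPair.{u} // Fintype.card P.R ≤ N} → Quotient RingUnitPair.isoSetoid :=
    fun P => ⟦P.1⟧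
  have hcode : cls.FactorsThrough code := by
    rintro ⟨P, hP⟩ ⟨Q, hQ⟩ h
    refine Quotient.sound ?_
    change P ≈ Q
    simp only [code] at h
    replace hP := Nat.lt_succ_of_le hP
    replace hQ := Nat.lt_succ_of_le hQ
    change (⟨⟨_, hP⟩, _⟩ : Σ n : Fin (N + 1), (Fin n → Fin n → Fin n) × (Fin n → Fin n → Fin n) ×
      Fin n) = ⟨⟨_, hQ⟩, _⟩ at h
    generalize Fintype.equivFin P.R = e at h
    generalize Fintype.equivFin Q.R = e' at h
    revert hP hQ e e' h
    -- Both cardinalities become variables so that they can be identified despite the dependent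
    -- types.
    generalize Fintype.card P.R = m
    generalize Fintype.card Q.R = n
    intro hP hQ e e' h
    obtain rfl : m = n := by simpa using congrArg (fun s => (s.1 : ℕ)) h
    simp only [Sigma.mk.injEq, heq_eq_eq, true_and, Prod.mk.injEq] at h
    obtain ⟨hadd, hmul, ht⟩ := h
    refine ⟨{ e.trans e'.symm with
      map_mul' := fun x y => ?_
      map_add' := fun x y => ?_ }, ?_⟩
    · have := congrFun (congrFun hmul (e x)) (e y)
      simpa using congrArg e'.symm this
    · have := congrFun (congrFun hadd (e x)) (e y)
      simpa using congrArg e'.symm this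
    · simpa using congrArg e'.symm ht
  rcases isEmpty_or_nonempty {P : RingUnitPair.{u} // Fintype.card P.R ≤ N} with hE | ⟨⟨P₀⟩⟩
  · rw [Set.image_eq_range]
    exact Set.finite_range (ι := {P : RingUnitPair.{u} // Fintype.card P.R ≤ N}) _
  -- The class is a function of the code, with the arbitrary value `cls P₀` at tables that come from
  -- no ring.
  · refine (Set.finite_range (Function.extend code cls fun _ => cls P₀)).subset ?_
    rintro _ ⟨P, hP, rfl⟩
    exact ⟨code ⟨P, hP⟩, hcode.extend_apply _ _⟩

end IncidenceSalem

theorem mainTheorem1 (C : ℝ) (hC : 0 < C) (d : ℕ) (hd : 2 ≤ d) :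
    ((fun P : IncidenceSalem.RingUnitPair.{u} => (⟦P⟧ : Quotient IncidenceSalem.RingUnitPair.isoSetoid)) ''
        {P | ¬ IsField P.R ∧ IncidenceSalem.salemNumber d P.t < C}).Finite ∧
    ∀ P : ℕ → IncidenceSalem.RingUnitPair.{u},
      Filter.Tendsto (fun i => Fintype.card (P i).R) Filter.atTop Filter.atTop →
      (∀ i, IncidenceSalem.IsSalem C d (P i).t) →
      ∀ᶠ i in Filter.atTop, IsField (P i).R := by
  refine ⟨?_, fun P hP hS => ?_⟩
  · refine (IncidenceSalem.RingUnitPair.finite_image_card_le ⌊16 * (2 * C ^ 2 + 1) ^ 6⌋₊).subset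
      (Set.image_mono ?_)
    rintro P ⟨hF, hlt⟩
    exact Nat.le_floor ((IncidenceSalem.isSalem_of_salemNumber_le hlt.le).card_le hd hF)
  · filter_upwards [hP.eventually_gt_atTop ⌊16 * (2 * C ^ 2 + 1) ^ 6⌋₊] with i hi
    by_contra hF
    exact hi.not_ge (Nat.le_floor ((hS i).card_le hd hF))
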